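/- Let $1\le p<\infty$, let $(X,\mathcal B,\mu)$ be a $\sigma$-finite measure space, and let $f:X\to X$ be a bijection such that $f$ and $f^{-1}$ are measurable, $f$ is non-singular (for $B\in\mathcal B$, $\mu(f^{-1}(B))=0$ if and only if $\mu(B)=0$), and, for some constant $c>0$, $\mu(f^{-1}(B))\le c\,\mu(B)$ for every $B\in\mathcal B$. Let $T_f:L^p(X)\to L^p(X)$, $T_f\varphi=\varphi\circ f$, be the induced bounded composition operator on the complex space $L^p(X)=L^p(X,\mathcal B,\mu;\mathbb C)$, and assume that $T_f$ is invertible, i.e. that it has a bounded inverse. Suppose that the system is dissipative and of bounded distortion, generated by $W$: that is, $W\in\mathcal B$, $0<\mu(W)<\infty$, $X$ is the disjoint union of the sets $f^k(W)$, $k\in\mathbb Z$, and there is $K>0$ such that $$\frac1K\,\mu(f^k(W))\,\mu(B)\le \mu(f^k(B))\,\mu(W)\le K\,\mu(f^k(W))\,\mu(B)$$ for all $k\in\mathbb Z$ and all $B\in\mathcal B$ with $B\subseteq W$. If one of the following conditions holds: - $(\mathcal{HC})$ $\displaystyle\limsup_{n\to\infty}\ \sup_{k\in\mathbb Z}\left(\frac{\mu(f^k(W))}{\mu(f^{k+n}(W))}\right)^{1/n}<1$;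 - $(\mathcal{HD})$ $\displaystyle\liminf_{n\to\infty}\ \inf_{k\in\mathbb Z}\left(\frac{\mu(f^k(W))}{\mu(f^{k+n}(W))}\right)^{1/n}>1$; - $(\mathcal{GH})$ $\displaystyle\limsup_{n\to\infty}\ \sup_{k\in\mathbb Z,\,k\le 0}\left(\frac{\mu(f^{k-n}(W))}{\mu(f^{k}(W))}\right)^{1/n}<1$ and $\displaystyle\liminf_{n\to\infty}\ \inf_{k\in\mathbb Z,\,k\ge 0}\left(\frac{\mu(f^k(W))}{\mu(f^{k+n}(W))}\right)^{1/n}>1$; then $T_f$ is strongly structurally stable: for every $\gamma>0$ there is $\varepsilon>0$ such that for every bounded Lipschitz map $\phi:L^p(X)\to L^p(X)$ with $\|\phi\|_\infty\le\varepsilon$ and $\mathrm{Lip}(\phi)\le\varepsilon$ there is a homeomorphism $h:L^p(X)\to L^p(X)$ with $h\circ T_f=(T_f+\phi)\circ h$ and $\|h(x)-x\|\le\gamma$ for all $x\in L^p(X)$. -/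

import Mathlib

open MeasureTheory Filter
open scoped ENNReal NNReal BoundedContinuousFunction

/-- A bounded operator `T` on a complex Banach space `E` is strongly
structurally stable if it is invertible and for every `γ > 0` there is `ε > 0` such that for every
bounded continuous `φ : E → E` with sup norm at most `ε` and Lipschitz constant at most `ε` there is
a homeomorphism `h` of `E` with `h ∘ T = (T + φ) ∘ h` and `‖h - I‖_∞ ≤ γ`. -/
def StronglyStructurallyStable {E : Type*} [NormedAddCommGroup E] [NormedSpace ℂ E]
    (T : E →L[ℂ] E) : Prop :=
  IsUnit T ∧
    ∀ γ : ℝ, 0 < γ → ∃ ε : ℝ≥0, 0 < ε ∧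
      ∀ φ : E →ᵇ E, ‖φ‖ ≤ ε → LipschitzWith ε φ →
        ∃ h : E ≃ₜ E, (∀ x, h (T x) = T (h x) + φ (h x)) ∧ ∀ x, ‖h x - x‖ ≤ γ

/-- The image `f ^ k (B)` for an integer `k`. -/
def iterImage {X : Type*} [MeasurableSpace X] (f : X ≃ᵐ X) (k : ℤ) (B : Set X) : Set X :=
  ((f.toEquiv : Equiv.Perm X) ^ k) '' B

/-- The conditions on a measure space and an invertible bimeasurable transformation `f` under which
composition with `f` is a bounded operator on `L^p`: the measure is `σ`-finite and
`μ (f⁻¹ B) ≤ c μ B` for a constant `c > 0` and all measurable `B`. -/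
structure IsCompositionSystem {X : Type*} [MeasurableSpace X] (μ : Measure X) (f : X ≃ᵐ X) :
    Prop where
  sigmaFinite : SigmaFinite μ
  bound : ∃ c : ℝ≥0, 0 < c ∧ ∀ B : Set X, MeasurableSet B → μ (f ⁻¹' B) ≤ c * μ B

/-- `(X, μ, f)` is a dissipative system generated by `W`. -/
structure IsDissipativeSystem {X : Type*} [MeasurableSpace X] (μ : Measure X) (f : X ≃ᵐ X)
    (W : Set X) : Prop where
  nonsingular : ∀ B : Set X, MeasurableSet B → (μ (f ⁻¹' B) = 0 ↔ μ B = 0)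
  measurableSet : MeasurableSet W
  measure_pos : 0 < μ W
  measure_lt_top : μ W < ∞
  pairwise_disjoint : Pairwise fun j k : ℤ => Disjoint (iterImage f j W) (iterImage f k W)
  iUnion_eq : ⋃ k : ℤ, iterImage f k W = Set.univ

/-- `(X, μ, f)` is a dissipative system, of bounded distortion, generated by `W`. -/
structure IsDissipativeSystemOfBoundedDistortion {X : Type*} [MeasurableSpace X] (μ : Measure X)
    (f : X ≃ᵐ X) (W : Set X) : Prop extends IsDissipativeSystem μ f W where
  bounded_distortion : ∃ K : ℝ≥0, 0 < K ∧ ∀ (k : ℤ) (B : Set X), MeasurableSet B → B ⊆ W →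
    (K : ℝ≥0∞)⁻¹ * (μ (iterImage f k W) * μ B) ≤ μ (iterImage f k B) * μ W ∧
    μ (iterImage f k B) * μ W ≤ K * (μ (iterImage f k W) * μ B)

namespace IsCompositionSystem

variable {X : Type*} [MeasurableSpace X] {μ : Measure X} {f : X ≃ᵐ X}

theorem exists_map_le (h : IsCompositionSystem μ f) :
    ∃ c : ℝ≥0, μ.map f ≤ (c : ℝ≥0∞) • μ := by
  obtain ⟨c, -, hc⟩ := h.bound
  refine ⟨c, Measure.le_iff.2 fun B hB => ?_⟩
  rw [Measure.map_apply f.measurable hB]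
  simpa using hc B hB

theorem quasiMeasurePreserving (h : IsCompositionSystem μ f) :
    Measure.QuasiMeasurePreserving f μ μ := by
  obtain ⟨c, hc⟩ := h.exists_map_le
  exact ⟨f.measurable, Measure.absolutelyContinuous_of_le_smul hc⟩

theorem memLp_comp (h : IsCompositionSystem μ f) {p : ℝ≥0∞} {φ : X → ℂ} (hφ : MemLp φ p μ) :
    MemLp (φ ∘ f) p μ := by
  obtain ⟨c, hc⟩ := h.exists_map_le
  exact (hφ.of_measure_le_smul ENNReal.coe_ne_top hc).comp_of_map f.measurable.aemeasurable

/-- The linear map `φ ↦ φ ∘ f` on (classes of functions in) `L^p(μ)`. -/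
noncomputable def compLinear (h : IsCompositionSystem μ f) (p : ℝ≥0∞) :
    Lp ℂ p μ →ₗ[ℂ] Lp ℂ p μ where
  toFun φ := (h.memLp_comp (Lp.memLp φ)).toLp (φ ∘ f)
  map_add' φ ψ := by
    rw [← MemLp.toLp_add]
    exact MemLp.toLp_congr _ _ (h.quasiMeasurePreserving.ae_eq_comp (Lp.coeFn_add φ ψ))
  map_smul' a φ := by
    rw [RingHom.id_apply, ← MemLp.toLp_const_smul]
    exact MemLp.toLp_congr _ _ (h.quasiMeasurePreserving.ae_eq_comp (Lp.coeFn_smul a φ))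

theorem exists_bound (h : IsCompositionSystem μ f) (p : ℝ≥0∞) (hp : p ≠ ∞) :
    ∃ C : ℝ, ∀ φ : Lp ℂ p μ, ‖h.compLinear p φ‖ ≤ C * ‖φ‖ := by
  obtain ⟨c, hc⟩ := h.exists_map_le
  refine ⟨((c : ℝ≥0∞) ^ (1 / p).toReal).toReal, fun φ => ?_⟩
  have hfin : (c : ℝ≥0∞) ^ (1 / p).toReal ≠ ∞ :=
    ENNReal.rpow_ne_top_of_nonneg ENNReal.toReal_nonneg ENNReal.coe_ne_top
  have key : eLpNorm (φ ∘ f) p μ ≤ (c : ℝ≥0∞) ^ (1 / p).toReal * eLpNorm φ p μ := by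
    have hm : AEStronglyMeasurable φ (μ.map f) :=
      (Lp.aestronglyMeasurable φ).mono_ac h.quasiMeasurePreserving.absolutelyContinuous
    rw [← eLpNorm_map_measure hm f.measurable.aemeasurable]
    refine (eLpNorm_mono_measure _ hc).trans ?_
    rw [eLpNorm_smul_measure_of_ne_top hp, smul_eq_mul]
  change ‖(h.memLp_comp (Lp.memLp φ)).toLp (φ ∘ f)‖ ≤ _
  rw [Lp.norm_toLp, Lp.norm_def, ← ENNReal.toReal_mul]
  exact ENNReal.toReal_mono (ENNReal.mul_ne_top hfin (Lp.eLpNorm_ne_top φ)) key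

/-- The composition operator `T_f : φ ↦ φ ∘ f`, a bounded operator on `L^p(μ)`, `1 ≤ p < ∞`. -/
noncomputable def compositionOperator (h : IsCompositionSystem μ f) (p : ℝ≥0∞) [Fact (1 ≤ p)]
    (hp : p ≠ ∞) : Lp ℂ p μ →L[ℂ] Lp ℂ p μ :=
  (h.compLinear p).mkContinuousOfExistsBound (h.exists_bound p hp)

end IsCompositionSystem

/-- Condition `HC`: `limsup_n sup_{k ∈ ℤ} (μ(f^k W) / μ(f^(k+n) W))^(1/n) < 1`. All three conditions
are stated in `[0, ∞]`; for the systems considered every `μ(f^k W)` is positive and finite. -/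
def ConditionHC {X : Type*} [MeasurableSpace X] (μ : Measure X) (f : X ≃ᵐ X) (W : Set X) : Prop :=
  limsup (fun n : ℕ => ⨆ k : ℤ,
    (μ (iterImage f k W) / μ (iterImage f (k + n) W)) ^ (1 / (n : ℝ))) atTop < 1

/-- Condition `HD`: `liminf_n inf_{k ∈ ℤ} (μ(f^k W) / μ(f^(k+n) W))^(1/n) > 1`. -/
def ConditionHD {X : Type*} [MeasurableSpace X] (μ : Measure X) (f : X ≃ᵐ X) (W : Set X) : Prop :=
  1 < liminf (fun n : ℕ => ⨅ k : ℤ,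
    (μ (iterImage f k W) / μ (iterImage f (k + n) W)) ^ (1 / (n : ℝ))) atTop

/-- Condition `GH`: `limsup_n sup_{k ≤ 0} (μ(f^(k-n) W) / μ(f^k W))^(1/n) < 1` and
`liminf_n inf_{k ≥ 0} (μ(f^k W) / μ(f^(k+n) W))^(1/n) > 1`. -/
def ConditionGH {X : Type*} [MeasurableSpace X] (μ : Measure X) (f : X ≃ᵐ X) (W : Set X) : Prop :=
  limsup (fun n : ℕ => ⨆ k : {k : ℤ // k ≤ 0},
    (μ (iterImage f (k - n) W) / μ (iterImage f k W)) ^ (1 / (n : ℝ))) atTop < 1 ∧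
  1 < liminf (fun n : ℕ => ⨅ k : {k : ℤ // 0 ≤ k},
    (μ (iterImage f k W) / μ (iterImage f (k + n) W)) ^ (1 / (n : ℝ))) atTop

/-!
Let `P` be multiplication by the indicator function of the union of those translates `f ^ k (W)`
whose measures decay exponentially towards the past; those of the remaining translates decay
towards the future. Bounded distortion transfers these rates from `W` to all of its measurable
subsets, so `‖T ^ n * P‖` and `‖T⁻¹ ^ n * (1 - P)‖` are summable.

Whenever `T` admits such a `P`, the equation `u ∘ R = T ∘ u + ψ` is solved, for every homeomorphism
`R`, by a linear operator whose norm is bounded independently of `R`. A map `id + u` semiconjugates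
`R₁ = T + φ₁` to `R₂ = T + φ₂` if `u ∘ R₁ = T ∘ u + φ₂ ∘ (id + u) - φ₁`, so for small Lipschitz
constants such a `u` is the fixed point of a contraction. If `u` belongs to `(R₁, R₂)` and `v` to
`(R₂, R₁)`, then `(id + v) ∘ (id + u)` is also obtained from a fixed point, now for `(R₁, R₁)`, and
uniqueness forces it to be the identity. Hence the semiconjugacies are homeomorphisms.
-/

section OrbitSum

variable {X Y 𝕜 E : Type*} [TopologicalSpace X] [TopologicalSpace Y]
  [NontriviallyNormedField 𝕜] [NormedAddCommGroup E] [NormedSpace 𝕜 E]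

theorem norm_compLeftContinuousBounded_comp_compContinuousCLM_le (A : E →L[𝕜] E) (σ : C(X, Y)) :
    ‖A.compLeftContinuousBounded X ∘L BoundedContinuousFunction.compContinuousCLM E 𝕜 σ‖ ≤ ‖A‖ :=
  ContinuousLinearMap.opNorm_le_bound _ (norm_nonneg A) fun ψ =>
    (BoundedContinuousFunction.norm_le (by positivity)).2 fun x =>
      A.le_opNorm_of_le (ψ.norm_coe_le_norm (σ x))

/-- The operator `ψ ↦ ∑ k, A ^ k ∘ B ∘ ψ ∘ R^[k]` on bounded continuous functions, which sums `ψ`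
along the forward orbits of `R` with weights `A ^ k * B`. -/
noncomputable def orbitSum (A B : E →L[𝕜] E) (R : C(X, X)) : (X →ᵇ E) →L[𝕜] (X →ᵇ E) :=
  ∑' k : ℕ, (A ^ k * B).compLeftContinuousBounded X ∘L
    BoundedContinuousFunction.compContinuousCLM E 𝕜 ⟨R^[k], R.continuous.iterate k⟩

variable {A B : E →L[𝕜] E} (hAB : Summable fun k : ℕ => ‖A ^ k * B‖)
include hAB

theorem norm_orbitSum_le (R : C(X, X)) : ‖orbitSum A B R‖ ≤ ∑' k : ℕ, ‖A ^ k * B‖ :=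
  tsum_of_norm_bounded hAB.hasSum fun _ =>
    norm_compLeftContinuousBounded_comp_compContinuousCLM_le _ _

variable [CompleteSpace E]

theorem hasSum_orbitSum_apply (R : C(X, X)) (ψ : X →ᵇ E) (x : X) :
    HasSum (fun k : ℕ => (A ^ k * B) (ψ (R^[k] x))) (orbitSum A B R ψ x) := by
  have hsum : Summable fun k : ℕ => (A ^ k * B).compLeftContinuousBounded X ∘L
      BoundedContinuousFunction.compContinuousCLM E 𝕜 ⟨R^[k], R.continuous.iterate k⟩ :=
    .of_norm_bounded hAB fun _ => norm_compLeftContinuousBounded_comp_compContinuousCLM_le _ _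
  exact (hsum.hasSum.mapL (ContinuousLinearMap.apply 𝕜 (X →ᵇ E) ψ)).mapL
    (BoundedContinuousFunction.evalCLM 𝕜 x)

theorem orbitSum_apply_eq_add (R : C(X, X)) (ψ : X →ᵇ E) (x : X) :
    orbitSum A B R ψ x = B (ψ x) + A (orbitSum A B R ψ (R x)) := by
  have tail : HasSum (fun k : ℕ => (A ^ (k + 1) * B) (ψ (R^[k + 1] x)))
      (A (orbitSum A B R ψ (R x))) :=
    ((hasSum_orbitSum_apply hAB R ψ (R x)).mapL A).congr_fun fun k => by
      rw [pow_succ', mul_assoc, mul_apply_eq_comp, Function.iterate_succ_apply]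
  have total := tail.zero_add (f := fun k : ℕ => (A ^ k * B) (ψ (R^[k] x)))
  rw [pow_zero, one_mul, Function.iterate_zero_apply] at total
  exact (hasSum_orbitSum_apply hAB R ψ x).unique total

theorem orbitSum_compContinuous {R : C(X, X)} {S : C(Y, Y)} {g : C(X, Y)}
    (hg : Function.Semiconj g R S) (ψ : Y →ᵇ E) :
    orbitSum A B R (ψ.compContinuous g) = (orbitSum A B S ψ).compContinuous g := by
  ext x
  refine (hasSum_orbitSum_apply hAB R _ x).unique ?_
  simpa only [BoundedContinuousFunction.compContinuous_apply, (hg.iterate_right _).eq]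
    using hasSum_orbitSum_apply hAB S ψ (g x)

end OrbitSum

section GreenOperator

variable {X Y 𝕜 E : Type*} [TopologicalSpace X] [TopologicalSpace Y]
  [NontriviallyNormedField 𝕜] [NormedAddCommGroup E] [NormedSpace 𝕜 E]

/-- `P` splits the space into a part on which the powers of the invertible operator `T` are
summable in norm and a part on which those of `T⁻¹` are. When `P` is a projection whose range is
mapped into itself by `T` and whose kernel is mapped into itself by `T⁻¹`, this is generalized
hyperbolicity of `T`; neither property is required here. -/
structure IsSummableSplitting (T : (E →L[𝕜] E)ˣ) (P : E →L[𝕜] E) : Prop where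
  summable_forward : Summable fun k : ℕ => ‖(T : E →L[𝕜] E) ^ k * P‖
  summable_backward : Summable fun k : ℕ => ‖(↑T⁻¹ : E →L[𝕜] E) ^ k * (1 - P)‖

/-- The Green operator `ψ ↦ u` of the cohomological equation `u ∘ R = T ∘ u + ψ`: it sums the
`P`-part of `ψ` over the past of `R` and subtracts the complementary part summed over the future. -/
noncomputable def greenOperator (T : (E →L[𝕜] E)ˣ) (P : E →L[𝕜] E) (R : X ≃ₜ X) :
    (X →ᵇ E) →L[𝕜] (X →ᵇ E) :=
  BoundedContinuousFunction.compContinuousCLM E 𝕜 (R.symm : C(X, X)) ∘L orbitSum T P R.symm -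
    (↑T⁻¹ : E →L[𝕜] E).compLeftContinuousBounded X ∘L orbitSum ↑T⁻¹ (1 - P) R

theorem greenOperator_apply (T : (E →L[𝕜] E)ˣ) (P : E →L[𝕜] E) (R : X ≃ₜ X) (ψ : X →ᵇ E) (x : X) :
    greenOperator T P R ψ x = orbitSum T P R.symm ψ (R.symm x) -
      (↑T⁻¹ : E →L[𝕜] E) (orbitSum ↑T⁻¹ (1 - P) R ψ x) :=
  rfl

/-- A bound on the norm of `greenOperator T P R` that is uniform in the homeomorphism `R`. -/
noncomputable def greenBound (T : (E →L[𝕜] E)ˣ) (P : E →L[𝕜] E) : ℝ≥0 :=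
  ∑' k : ℕ, ‖(T : E →L[𝕜] E) ^ k * P‖₊ +
    ‖(↑T⁻¹ : E →L[𝕜] E)‖₊ * ∑' k : ℕ, ‖(↑T⁻¹ : E →L[𝕜] E) ^ k * (1 - P)‖₊

namespace IsSummableSplitting

variable {T : (E →L[𝕜] E)ˣ} {P : E →L[𝕜] E} (h : IsSummableSplitting T P)
include h

theorem norm_greenOperator_apply_le (R : X ≃ₜ X) (ψ : X →ᵇ E) :
    ‖greenOperator T P R ψ‖ ≤ greenBound T P * ‖ψ‖ := by
  simp only [greenBound, NNReal.coe_add, NNReal.coe_mul, NNReal.coe_tsum, coe_nnnorm, add_mul,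
    mul_assoc]
  refine (norm_sub_le _ _).trans (add_le_add ?_ ?_)
  · exact (BoundedContinuousFunction.norm_compContinuous_le _ _).trans
      (ContinuousLinearMap.le_of_opNorm_le _ (norm_orbitSum_le h.summable_forward _) ψ)
  · refine (BoundedContinuousFunction.norm_le (by positivity)).2 fun x =>
      ContinuousLinearMap.le_opNorm_of_le _ ?_
    exact (BoundedContinuousFunction.norm_coe_le_norm _ x).trans
      (ContinuousLinearMap.le_of_opNorm_le _ (norm_orbitSum_le h.summable_backward _) ψ)

variable [CompleteSpace E]

theorem greenOperator_apply_homeomorph (R : X ≃ₜ X) (ψ : X →ᵇ E) (x : X) :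
    greenOperator T P R ψ (R x) = (T : E →L[𝕜] E) (greenOperator T P R ψ x) + ψ x := by
  have T_inv (v : E) : (T : E →L[𝕜] E) ((↑T⁻¹ : E →L[𝕜] E) v) = v :=
    DFunLike.congr_fun T.mul_inv v
  have forward := orbitSum_apply_eq_add h.summable_forward (R.symm : C(X, X)) ψ x
  have backward := orbitSum_apply_eq_add h.summable_backward (R : C(X, X)) ψ x
  simp only [greenOperator_apply, map_sub, T_inv, ContinuousMap.coe_coe, R.symm_apply_apply]
    at forward backward ⊢
  rw [forward, backward, sub_apply, one_apply_eq_self]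
  abel

theorem greenOperator_compContinuous {R : X ≃ₜ X} {S : Y ≃ₜ Y} {g : C(X, Y)}
    (hg : Function.Semiconj g R S) (ψ : Y →ᵇ E) :
    greenOperator T P R (ψ.compContinuous g) = (greenOperator T P S ψ).compContinuous g := by
  have hg' : Function.Semiconj g R.symm S.symm :=
    hg.inverses_right R.apply_symm_apply S.symm_apply_apply
  ext x
  rw [greenOperator_apply, orbitSum_compContinuous h.summable_forward (S := (S.symm : C(Y, Y))) hg',
    orbitSum_compContinuous h.summable_backward (S := (S : C(Y, Y))) hg]
  simp [greenOperator_apply, hg'.eq]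

end IsSummableSplitting

end GreenOperator

section Conjugacy

variable {𝕜 E : Type*} [NontriviallyNormedField 𝕜] [NormedAddCommGroup E] [NormedSpace 𝕜 E]

/-- The map `x ↦ x + u x`, the form in which conjugacies are sought. -/
def idAdd (u : E →ᵇ E) : C(E, E) :=
  ContinuousMap.id E + u.toContinuousMap

theorem idAdd_apply (u : E →ᵇ E) (x : E) : idAdd u x = x + u x :=
  rfl

theorem lipschitzWith_compContinuous_idAdd {φ : E →ᵇ E} {ε : ℝ≥0} (hφ : LipschitzWith ε φ) :
    LipschitzWith ε fun u : E →ᵇ E => φ.compContinuous (idAdd u) :=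
  .of_dist_le_mul fun u v => (BoundedContinuousFunction.dist_le (by positivity)).2 fun x => by
    refine (hφ.dist_le_mul _ _).trans (mul_le_mul_of_nonneg_left ?_ ε.coe_nonneg)
    rw [idAdd_apply, idAdd_apply, dist_add_left]
    exact BoundedContinuousFunction.dist_coe_le_dist x

/-- The map used to construct conjugacies: a fixed point `u` solves
`u ∘ R = T ∘ u + φ₂ ∘ (id + u) - φ₁`, which for `R = T + φ₁` says that `id + u` semiconjugates `R`
to `T + φ₂`. -/
noncomputable def conjugacyMap (T : (E →L[𝕜] E)ˣ) (P : E →L[𝕜] E) (R : E ≃ₜ E)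
    (φ₁ φ₂ u : E →ᵇ E) : E →ᵇ E :=
  greenOperator T P R (φ₂.compContinuous (idAdd u) - φ₁)

namespace IsSummableSplitting

variable {T : (E →L[𝕜] E)ˣ} {P : E →L[𝕜] E} (h : IsSummableSplitting T P)
include h

theorem contractingWith_conjugacyMap {ε : ℝ≥0} (hε : greenBound T P * ε < 1) (R : E ≃ₜ E)
    (φ₁ : E →ᵇ E) {φ₂ : E →ᵇ E} (hφ₂ : LipschitzWith ε φ₂) :
    ContractingWith (greenBound T P * ε) (conjugacyMap T P R φ₁ φ₂) := by
  refine ⟨hε, .of_dist_le_mul fun u v => ?_⟩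
  rw [dist_eq_norm, conjugacyMap, conjugacyMap, ← map_sub, sub_sub_sub_cancel_right, NNReal.coe_mul,
    mul_assoc]
  refine (h.norm_greenOperator_apply_le R _).trans ?_
  gcongr
  rw [← dist_eq_norm]
  exact (lipschitzWith_compContinuous_idAdd hφ₂).dist_le_mul u v

theorem norm_le_of_isFixedPt_conjugacyMap {R : E ≃ₜ E} {φ₁ φ₂ u : E →ᵇ E}
    (hu : Function.IsFixedPt (conjugacyMap T P R φ₁ φ₂) u) :
    ‖u‖ ≤ greenBound T P * (‖φ₁‖ + ‖φ₂‖) := by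
  rw [← hu.eq, add_comm]
  refine (h.norm_greenOperator_apply_le R _).trans ?_
  gcongr
  exact (norm_sub_le _ _).trans (add_le_add_left
    (BoundedContinuousFunction.norm_compContinuous_le _ _) _)

variable [CompleteSpace E]

theorem semiconj_idAdd_of_isFixedPt {R₁ R₂ : E ≃ₜ E} {φ₁ φ₂ u : E →ᵇ E}
    (hR₁ : ∀ x, R₁ x = (T : E →L[𝕜] E) x + φ₁ x) (hR₂ : ∀ x, R₂ x = (T : E →L[𝕜] E) x + φ₂ x)
    (hu : Function.IsFixedPt (conjugacyMap T P R₁ φ₁ φ₂) u) :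
    Function.Semiconj (idAdd u) R₁ R₂ := fun x => by
  have cohomological : u (R₁ x) = (T : E →L[𝕜] E) (u x) + (φ₂ (x + u x) - φ₁ x) := by
    have := h.greenOperator_apply_homeomorph R₁ (φ₂.compContinuous (idAdd u) - φ₁) x
    rwa [show greenOperator T P R₁ (φ₂.compContinuous (idAdd u) - φ₁) = u from hu] at this
  rw [idAdd_apply, idAdd_apply, cohomological, hR₁, hR₂, map_add T.val]
  abel

theorem isFixedPt_conjugacyMap_add {R₁ R₂ : E ≃ₜ E} {φ₁ φ₂ φ₃ u v : E →ᵇ E}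
    (hR₁ : ∀ x, R₁ x = (T : E →L[𝕜] E) x + φ₁ x) (hR₂ : ∀ x, R₂ x = (T : E →L[𝕜] E) x + φ₂ x)
    (hu : Function.IsFixedPt (conjugacyMap T P R₁ φ₁ φ₂) u)
    (hv : Function.IsFixedPt (conjugacyMap T P R₂ φ₂ φ₃) v) :
    Function.IsFixedPt (conjugacyMap T P R₁ φ₁ φ₃) (u + v.compContinuous (idAdd u)) := by
  have semiconj := h.semiconj_idAdd_of_isFixedPt hR₁ hR₂ hu
  calc conjugacyMap T P R₁ φ₁ φ₃ (u + v.compContinuous (idAdd u))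
      = greenOperator T P R₁ ((φ₂.compContinuous (idAdd u) - φ₁) +
          (φ₃.compContinuous (idAdd v) - φ₂).compContinuous (idAdd u)) := by
        refine congrArg (greenOperator T P R₁) ?_
        ext x
        simp [idAdd_apply, add_assoc]
    _ = conjugacyMap T P R₁ φ₁ φ₂ u + (conjugacyMap T P R₂ φ₂ φ₃ v).compContinuous (idAdd u) := by
        rw [map_add, h.greenOperator_compContinuous semiconj]
        rfl
    _ = u + v.compContinuous (idAdd u) := by rw [hu.eq, hv.eq]

theorem leftInverse_idAdd {ε : ℝ≥0} (hε : greenBound T P * ε < 1) {R₁ R₂ : E ≃ₜ E}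
    {φ₁ φ₂ u v : E →ᵇ E} (hφ₁ : LipschitzWith ε φ₁)
    (hR₁ : ∀ x, R₁ x = (T : E →L[𝕜] E) x + φ₁ x) (hR₂ : ∀ x, R₂ x = (T : E →L[𝕜] E) x + φ₂ x)
    (hu : Function.IsFixedPt (conjugacyMap T P R₁ φ₁ φ₂) u)
    (hv : Function.IsFixedPt (conjugacyMap T P R₂ φ₂ φ₁) v) :
    Function.LeftInverse (idAdd v) (idAdd u) := fun x => by
  have zero_fixed : Function.IsFixedPt (conjugacyMap T P R₁ φ₁ φ₁) 0 := by
    have : φ₁.compContinuous (idAdd 0) - φ₁ = 0 := by ext x; simp [idAdd_apply]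
    rw [Function.IsFixedPt, conjugacyMap, this, map_zero]
  have sum_eq_zero : u + v.compContinuous (idAdd u) = 0 :=
    (h.contractingWith_conjugacyMap hε R₁ φ₁ hφ₁).fixedPoint_unique'
      (h.isFixedPt_conjugacyMap_add hR₁ hR₂ hu hv) zero_fixed
  calc idAdd v (idAdd u x) = x + (u + v.compContinuous (idAdd u)) x := add_assoc _ _ _
    _ = x := by rw [sum_eq_zero, BoundedContinuousFunction.coe_zero, Pi.zero_apply, add_zero]

theorem exists_homeomorph_semiconj {ε : ℝ≥0} (hε : greenBound T P * ε < 1) {R₁ R₂ : E ≃ₜ E}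
    {φ₁ φ₂ : E →ᵇ E} (hφ₁ : LipschitzWith ε φ₁) (hφ₂ : LipschitzWith ε φ₂)
    (hR₁ : ∀ x, R₁ x = (T : E →L[𝕜] E) x + φ₁ x) (hR₂ : ∀ x, R₂ x = (T : E →L[𝕜] E) x + φ₂ x) :
    ∃ g : E ≃ₜ E, Function.Semiconj g R₁ R₂ ∧
      ∀ x, ‖g x - x‖ ≤ greenBound T P * (‖φ₁‖ + ‖φ₂‖) := by
  have hu := (h.contractingWith_conjugacyMap hε R₁ φ₁ hφ₂).fixedPoint_isFixedPt
  have hv := (h.contractingWith_conjugacyMap hε R₂ φ₂ hφ₁).fixedPoint_isFixedPt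
  refine ⟨⟨⟨_, _, h.leftInverse_idAdd hε hφ₁ hR₁ hR₂ hu hv,
    h.leftInverse_idAdd hε hφ₂ hR₂ hR₁ hv hu⟩, (idAdd _).continuous, (idAdd _).continuous⟩,
    h.semiconj_idAdd_of_isFixedPt hR₁ hR₂ hu, fun x => ?_⟩
  refine (congrArg norm (add_sub_cancel_left x _)).trans_le ?_
  exact (BoundedContinuousFunction.norm_coe_le_norm _ x).trans
    (h.norm_le_of_isFixedPt_conjugacyMap hu)

end IsSummableSplitting

theorem exists_homeomorph_eq_add [CompleteSpace E] (T : (E →L[𝕜] E)ˣ) {ε : ℝ≥0}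
    (hε : ‖(↑T⁻¹ : E →L[𝕜] E)‖₊ * ε < 1) {φ : E → E} (hφ : LipschitzWith ε φ) :
    ∃ R : E ≃ₜ E, ∀ x, R x = (T : E →L[𝕜] E) x + φ x := by
  let e := ContinuousLinearEquiv.unitsEquiv 𝕜 E T
  have approx :
      ApproximatesLinearOn (fun x => (T : E →L[𝕜] E) x + φ x) (e : E →L[𝕜] E) Set.univ ε := by
    refine ApproximatesLinearOn.approximatesLinearOn_iff_lipschitzOnWith.2
      (LipschitzWith.lipschitzOnWith ?_)
    rwa [show (fun x => (T : E →L[𝕜] E) x + φ x) - ⇑(e : E →L[𝕜] E) = φ from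
      funext fun x => add_sub_cancel_left _ _]
  refine ⟨approx.toHomeomorph _ ?_, fun x => rfl⟩
  refine e.subsingleton_or_nnnorm_symm_pos.imp_right fun hpos => ?_
  exact (NNReal.lt_inv_iff_mul_lt hpos.ne').2 ((mul_comm _ _).trans_lt hε)

end Conjugacy

theorem IsSummableSplitting.stronglyStructurallyStable {E : Type*} [NormedAddCommGroup E]
    [NormedSpace ℂ E] [CompleteSpace E] {T : (E →L[ℂ] E)ˣ} {P : E →L[ℂ] E}
    (h : IsSummableSplitting T P) : StronglyStructurallyStable (T : E →L[ℂ] E) := by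
  refine ⟨T.isUnit, fun γ hγ => ?_⟩
  obtain ⟨ε, hε, hεlt⟩ := exists_pos_mul_lt (lt_min one_pos hγ)
    (greenBound T P + ‖(↑T⁻¹ : E →L[ℂ] E)‖ : ℝ)
  lift ε to ℝ≥0 using hε.le
  have green_nonneg : (0 : ℝ) ≤ greenBound T P * ε := by positivity
  have inv_nonneg : 0 ≤ ‖(↑T⁻¹ : E →L[ℂ] E)‖ * ε := by positivity
  rw [add_mul, lt_min_iff] at hεlt
  have green_lt_one : greenBound T P * ε < 1 :=
    mod_cast (by linarith : (greenBound T P * ε : ℝ) < 1)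
  have inv_lt_one : ‖(↑T⁻¹ : E →L[ℂ] E)‖₊ * ε < 1 :=
    mod_cast (by linarith : ‖(↑T⁻¹ : E →L[ℂ] E)‖ * ε < 1)
  have green_le : greenBound T P * ε ≤ γ := by linarith
  refine ⟨ε, mod_cast hε, fun φ hφ hφLip => ?_⟩
  obtain ⟨R, hR⟩ := exists_homeomorph_eq_add T inv_lt_one hφLip
  obtain ⟨g, hg, hg_near⟩ := h.exists_homeomorph_semiconj green_lt_one (φ₁ := 0)
    (R₁ := (ContinuousLinearEquiv.unitsEquiv ℂ E T).toHomeomorph) (.const' 0) hφLip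
    (fun x => (add_zero _).symm) hR
  refine ⟨g, fun x => (hg x).trans (hR _), fun x => (hg_near x).trans (le_trans ?_ green_le)⟩
  rw [norm_zero, zero_add]
  gcongr

section IterImage

variable {X : Type*} [MeasurableSpace X] {f : X ≃ᵐ X}

theorem iterImage_zero (B : Set X) : iterImage f 0 B = B := by
  simp [iterImage]

theorem iterImage_add (j k : ℤ) (B : Set X) :
    iterImage f (j + k) B = iterImage f j (iterImage f k B) := by
  simp [iterImage, zpow_add, Set.image_image]

theorem preimage_zpow_eq_iterImage (k : ℤ) (B : Set X) :
    ⇑((f.toEquiv : Equiv.Perm X) ^ k) ⁻¹' B = iterImage f (-k) B := by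
  rw [iterImage, zpow_neg, Equiv.Perm.inv_def, Equiv.image_symm_eq_preimage]

theorem measurable_zpow_toEquiv (f : X ≃ᵐ X) (k : ℤ) :
    Measurable ⇑((f.toEquiv : Equiv.Perm X) ^ k) :=
  zpow_induction_right (P := fun σ : Equiv.Perm X => Measurable σ) measurable_id
    (fun _ hσ => hσ.comp f.measurable) (fun _ hσ => hσ.comp f.symm.measurable) k

theorem measurableSet_iterImage (k : ℤ) {B : Set X} (hB : MeasurableSet B) :
    MeasurableSet (iterImage f k B) := by
  rw [← neg_neg k, ← preimage_zpow_eq_iterImage]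
  exact measurable_zpow_toEquiv f (-k) hB

end IterImage

namespace IsDissipativeSystem

variable {X : Type*} [MeasurableSpace X] {μ : Measure X} {f : X ≃ᵐ X} {W : Set X}
  (h : IsDissipativeSystem μ f W)
include h

theorem quasiMeasurePreserving : Measure.QuasiMeasurePreserving f μ μ :=
  ⟨f.measurable, .mk fun B hB hμB => by
    rwa [Measure.map_apply f.measurable hB, h.nonsingular B hB]⟩

theorem quasiMeasurePreserving_symm : Measure.QuasiMeasurePreserving f.symm μ μ :=
  ⟨f.symm.measurable, .mk fun B hB hμB => by
    rwa [Measure.map_apply f.symm.measurable hB, ← h.nonsingular _ (f.symm.measurable hB),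
      ← Set.preimage_comp, f.symm_comp_self, Set.preimage_id]⟩

theorem quasiMeasurePreserving_zpow (k : ℤ) :
    Measure.QuasiMeasurePreserving ⇑((f.toEquiv : Equiv.Perm X) ^ k) μ μ :=
  zpow_induction_right (P := fun σ : Equiv.Perm X => Measure.QuasiMeasurePreserving σ μ μ)
    (.id μ) (fun _ hσ => hσ.comp h.quasiMeasurePreserving)
    (fun _ hσ => hσ.comp h.quasiMeasurePreserving_symm) k

theorem measure_iterImage_ne_zero (k : ℤ) : μ (iterImage f k W) ≠ 0 := fun hk => by
  have hW : μ (⇑((f.toEquiv : Equiv.Perm X) ^ k) ⁻¹' iterImage f k W) = 0 :=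
    (h.quasiMeasurePreserving_zpow k).preimage_null hk
  rw [preimage_zpow_eq_iterImage, ← iterImage_add, neg_add_cancel, iterImage_zero] at hW
  exact h.measure_pos.ne' hW

end IsDissipativeSystem

theorem restrict_biUnion_le_of_forall_restrict_le {X ι : Type*} [MeasurableSpace X]
    {μ ν : Measure X} {S : Set ι} (hS : S.Countable) {A : ι → Set X}
    (hA : ∀ i ∈ S, MeasurableSet (A i)) (hdisj : S.PairwiseDisjoint A)
    (h : ∀ i ∈ S, ν.restrict (A i) ≤ μ) : ν.restrict (⋃ i ∈ S, A i) ≤ μ := by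
  refine Measure.le_iff.2 fun B hB => ?_
  have := hS.to_subtype
  have piece (i : ι) (hi : i ∈ S) : ν (B ∩ A i) ≤ μ (B ∩ A i) := by
    simpa [Measure.restrict_apply' (hA i hi), Set.inter_assoc] using h i hi (B ∩ A i)
  calc ν.restrict (⋃ i ∈ S, A i) B = ν (⋃ i ∈ S, B ∩ A i) := by
        rw [Measure.restrict_apply hB, Set.inter_iUnion₂]
    _ ≤ ∑' i : S, ν (B ∩ A i) := measure_biUnion_le ν hS _
    _ ≤ ∑' i : S, μ (B ∩ A i) := ENNReal.tsum_le_tsum fun i => piece i i.2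
    _ = μ (⋃ i ∈ S, B ∩ A i) := (measure_biUnion hS
        (hdisj.mono fun i => Set.inter_subset_right) fun i hi => hB.inter (hA i hi)).symm
    _ ≤ μ B := measure_mono (Set.iUnion₂_subset fun _ _ => Set.inter_subset_left)

namespace IsDissipativeSystemOfBoundedDistortion

variable {X : Type*} [MeasurableSpace X] {μ : Measure X} {f : X ≃ᵐ X} {W : Set X}
  (h : IsDissipativeSystemOfBoundedDistortion μ f W)
include h

theorem exists_measure_iterImage_le :
    ∃ C : ℝ≥0, ∀ (j k : ℤ) (c : ℝ≥0), μ (iterImage f j W) ≤ c * μ (iterImage f k W) →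
      ∀ B, MeasurableSet B → B ⊆ W →
        μ (iterImage f j B) ≤ (C * c : ℝ≥0) * μ (iterImage f k B) := by
  obtain ⟨K, hK, hdist⟩ := h.bounded_distortion
  refine ⟨K * K, fun j k c hc B hB hBW => ?_⟩
  have lower : μ (iterImage f k W) * μ B ≤ K * (μ (iterImage f k B) * μ W) := by
    have := (hdist k B hB hBW).1
    rwa [mul_comm, ← div_eq_mul_inv, ENNReal.div_le_iff' (by simpa using hK.ne') ENNReal.coe_ne_top]
      at this
  rw [← ENNReal.mul_le_mul_iff_left h.measure_pos.ne' h.measure_lt_top.ne]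
  calc μ (iterImage f j B) * μ W
      ≤ K * (μ (iterImage f j W) * μ B) := (hdist j B hB hBW).2
    _ ≤ K * (c * μ (iterImage f k W) * μ B) := by gcongr
    _ = K * c * (μ (iterImage f k W) * μ B) := by ring
    _ ≤ K * c * (K * (μ (iterImage f k B) * μ W)) := by gcongr
    _ = (K * K * c : ℝ≥0) * μ (iterImage f k B) * μ W := by push_cast; ring

theorem exists_restrict_map_zpow_le :
    ∃ C : ℝ≥0, ∀ (m : ℤ) (S : Set ℤ) (c : ℝ≥0),
      (∀ k ∈ S, μ (iterImage f (k - m) W) ≤ c * μ (iterImage f k W)) →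
      (μ.map ⇑((f.toEquiv : Equiv.Perm X) ^ m)).restrict (⋃ k ∈ S, iterImage f k W) ≤
        (C * c) • μ := by
  obtain ⟨C, hC⟩ := h.exists_measure_iterImage_le
  refine ⟨C, fun m S c hc => restrict_biUnion_le_of_forall_restrict_le S.to_countable
    (fun k _ => measurableSet_iterImage k h.measurableSet) (h.pairwise_disjoint.set_pairwise S)
    fun k hk => Measure.le_iff.2 fun B hB => ?_⟩
  have hBk : MeasurableSet (B ∩ iterImage f k W) :=
    hB.inter (measurableSet_iterImage k h.measurableSet)
  have hBW : iterImage f (-k) (B ∩ iterImage f k W) ⊆ W :=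
    (Set.image_mono Set.inter_subset_right).trans_eq
      (by rw [← iterImage, ← iterImage_add, neg_add_cancel, iterImage_zero])
  have := hC _ _ c (hc k hk) _ (measurableSet_iterImage _ hBk) hBW
  rw [← iterImage_add, ← iterImage_add, ← sub_eq_add_neg, sub_sub_cancel_left, ← sub_eq_add_neg,
    sub_self, iterImage_zero] at this
  rw [Measure.restrict_apply hB, Measure.map_apply (measurable_zpow_toEquiv f m) hBk,
    preimage_zpow_eq_iterImage]
  exact this.trans (mul_le_mul_right (measure_mono Set.inter_subset_left) _)

end IsDissipativeSystemOfBoundedDistortion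

section LpIndicator

variable {X 𝕜 E : Type*} [MeasurableSpace X] {μ : Measure X} [NontriviallyNormedField 𝕜]
  [NormedAddCommGroup E] [NormedSpace 𝕜 E] {p : ℝ≥0∞} [Fact (1 ≤ p)] {A : Set X}

/-- Multiplication by the indicator function of a measurable set, as an operator on `L^p`. -/
noncomputable def lpIndicator (hA : MeasurableSet A) : Lp E p μ →L[𝕜] Lp E p μ :=
  (ContinuousLinearMap.lsmul 𝕜 𝕜 : 𝕜 →L[𝕜] E →L[𝕜] E).holderL μ ∞ p p
    (((memLp_top_const (1 : 𝕜)).indicator hA).toLp _)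

theorem coeFn_lpIndicator (hA : MeasurableSet A) (φ : Lp E p μ) :
    lpIndicator (𝕜 := 𝕜) hA φ =ᵐ[μ] A.indicator φ := by
  have hφ := (ContinuousLinearMap.lsmul 𝕜 𝕜 : 𝕜 →L[𝕜] E →L[𝕜] E).coeFn_holder (r := p)
    (((memLp_top_const (μ := μ) (1 : 𝕜)).indicator hA).toLp _) φ
  filter_upwards [hφ, ((memLp_top_const (μ := μ) (1 : 𝕜)).indicator hA).coeFn_toLp] with x hx h_ind
  refine hx.trans ?_
  rw [h_ind]
  by_cases hxA : x ∈ A <;> simp [hxA]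

theorem one_sub_lpIndicator (hA : MeasurableSet A) :
    1 - lpIndicator hA = (lpIndicator hA.compl : Lp E p μ →L[𝕜] Lp E p μ) := by
  ext φ
  change (φ - lpIndicator (𝕜 := 𝕜) hA φ : Lp E p μ) =ᵐ[μ] _
  filter_upwards [Lp.coeFn_sub φ (lpIndicator (𝕜 := 𝕜) hA φ), coeFn_lpIndicator (𝕜 := 𝕜) hA φ,
    coeFn_lpIndicator (𝕜 := 𝕜) hA.compl φ] with x h_sub hx hx_compl
  rw [h_sub, hx_compl, Set.indicator_compl, Pi.sub_apply, Pi.sub_apply, hx]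

theorem norm_comp_lpIndicator_le {Y : Type*} [MeasurableSpace Y] {ν : Measure Y} (hp : p ≠ ∞)
    (hA : MeasurableSet A) {g : Y → X} (hg : Measure.QuasiMeasurePreserving g ν μ)
    {S : Lp E p μ →L[𝕜] Lp E p ν} (hS : ∀ φ, S φ =ᵐ[ν] φ ∘ g) {c : ℝ≥0}
    (hc : (ν.map g).restrict A ≤ c • μ) : ‖S ∘L lpIndicator hA‖ ≤ c ^ p.toReal⁻¹ := by
  refine ContinuousLinearMap.opNorm_le_bound _ (by positivity) fun φ => ?_
  have key :
      eLpNorm (S (lpIndicator (𝕜 := 𝕜) hA φ)) p ν ≤ (c ^ p.toReal⁻¹ : ℝ≥0) * eLpNorm φ p μ :=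
    calc eLpNorm (S (lpIndicator (𝕜 := 𝕜) hA φ)) p ν
        = eLpNorm (A.indicator φ ∘ g) p ν :=
          eLpNorm_congr_ae ((hS _).trans (hg.ae_eq_comp (coeFn_lpIndicator hA φ)))
      _ = eLpNorm (A.indicator φ) p (ν.map g) := (eLpNorm_map_measure
          (((Lp.aestronglyMeasurable φ).indicator hA).mono_ac hg.absolutelyContinuous)
          hg.aemeasurable).symm
      _ = eLpNorm φ p ((ν.map g).restrict A) := eLpNorm_indicator_eq_eLpNorm_restrict hA
      _ ≤ eLpNorm φ p (c • μ) := eLpNorm_mono_measure _ hc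
      _ = (c ^ p.toReal⁻¹ : ℝ≥0) * eLpNorm φ p μ := eLpNorm_smul_measure_of_ne_top' hp c φ
  have := ENNReal.toReal_mono (ENNReal.mul_ne_top ENNReal.coe_ne_top (Lp.eLpNorm_ne_top φ)) key
  rw [ENNReal.toReal_mul, ← Lp.norm_def, ← Lp.norm_def] at this
  exact this

end LpIndicator

section ExponentialDecay

variable {X : Type*} [MeasurableSpace X] {μ : Measure X} {f : X ≃ᵐ X} {W : Set X}
  {p : ℝ≥0∞} [Fact (1 ≤ p)]

theorem coeFn_zpow_compositionOperator (hp : p ≠ ∞) (hcomp : IsCompositionSystem μ f)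
    (hdiss : IsDissipativeSystem μ f W) {T : (Lp ℂ p μ →L[ℂ] Lp ℂ p μ)ˣ}
    (hT : (T : Lp ℂ p μ →L[ℂ] Lp ℂ p μ) = hcomp.compositionOperator p hp) (m : ℤ)
    (φ : Lp ℂ p μ) :
    (↑(T ^ m) : Lp ℂ p μ →L[ℂ] Lp ℂ p μ) φ =ᵐ[μ] φ ∘ ⇑((f.toEquiv : Equiv.Perm X) ^ m) := by
  have coeFn_T (ψ : Lp ℂ p μ) : (T : Lp ℂ p μ →L[ℂ] Lp ℂ p μ) ψ =ᵐ[μ] ψ ∘ f := by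
    rw [hT]
    exact MemLp.coeFn_toLp (hcomp.memLp_comp (Lp.memLp ψ))
  have coeFn_T_inv (ψ : Lp ℂ p μ) : (↑T⁻¹ : Lp ℂ p μ →L[ℂ] Lp ℂ p μ) ψ =ᵐ[μ] ψ ∘ f.symm := by
    have hψ := hdiss.quasiMeasurePreserving_symm.ae_eq_comp
      (coeFn_T ((↑T⁻¹ : Lp ℂ p μ →L[ℂ] Lp ℂ p μ) ψ))
    rw [← mul_apply_eq_comp, T.mul_inv, one_apply_eq_self, Function.comp_assoc,
      f.self_comp_symm, Function.comp_id] at hψ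
    exact hψ.symm
  induction m with
  | zero => rfl
  | succ m ih =>
    rw [add_comm, zpow_one_add, add_comm, zpow_add_one]
    exact (coeFn_T _).trans (hdiss.quasiMeasurePreserving.ae_eq_comp ih)
  | pred m ih =>
    rw [sub_eq_add_neg, add_comm, zpow_add, add_comm, zpow_add, zpow_neg_one, zpow_neg_one]
    exact (coeFn_T_inv _).trans (hdiss.quasiMeasurePreserving_symm.ae_eq_comp ih)

theorem summable_of_eventually_le_rpow {u : ℕ → ℝ} (hu : ∀ n, 0 ≤ u n) {C r : ℝ≥0} (hr : r < 1)
    {a : ℝ} (ha : 0 < a) (h : ∀ᶠ n in atTop, u n ≤ (C * r ^ n : ℝ≥0) ^ a) : Summable u := by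
  have geometric : Summable fun n : ℕ => ((C ^ a * (r ^ a) ^ n : ℝ≥0) : ℝ) :=
    NNReal.summable_coe.2 ((NNReal.summable_geometric (NNReal.rpow_lt_one hr ha)).mul_left _)
  refine .of_norm_bounded_eventually_nat geometric (h.mono fun n hn => ?_)
  rw [Real.norm_of_nonneg (hu n)]
  refine hn.trans_eq ?_
  rw [← NNReal.coe_rpow, NNReal.mul_rpow, ← NNReal.rpow_natCast, ← NNReal.rpow_natCast,
    ← NNReal.rpow_mul, ← NNReal.rpow_mul, mul_comm (n : ℝ)]

theorem summable_norm_zpow_mul_lpIndicator (hp : p ≠ ∞) (hcomp : IsCompositionSystem μ f)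
    (hdiss : IsDissipativeSystemOfBoundedDistortion μ f W) {T : (Lp ℂ p μ →L[ℂ] Lp ℂ p μ)ˣ}
    (hT : (T : Lp ℂ p μ →L[ℂ] Lp ℂ p μ) = hcomp.compositionOperator p hp) {S : Set ℤ}
    (hS : MeasurableSet (⋃ k ∈ S, iterImage f k W)) {r : ℝ≥0} (hr : r < 1) {m : ℕ → ℤ}
    (hdecay : ∀ᶠ n in atTop, ∀ k ∈ S, μ (iterImage f (k - m n) W) ≤ r ^ n * μ (iterImage f k W)) :
    Summable fun n => ‖(↑(T ^ m n) : Lp ℂ p μ →L[ℂ] Lp ℂ p μ) * lpIndicator hS‖ := by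
  obtain ⟨C, hC⟩ := hdiss.exists_restrict_map_zpow_le
  have hp_pos : 0 < p.toReal := ENNReal.toReal_pos (zero_lt_one.trans_le Fact.out).ne' hp
  refine summable_of_eventually_le_rpow (C := C) (fun _ => norm_nonneg _) hr (inv_pos.2 hp_pos)
    (hdecay.mono fun n hn => ?_)
  exact norm_comp_lpIndicator_le hp hS (hdiss.quasiMeasurePreserving_zpow (m n))
    (coeFn_zpow_compositionOperator hp hcomp hdiss.toIsDissipativeSystem hT (m n))
    (hC (m n) S (r ^ n) (by exact_mod_cast hn))

theorem stronglyStructurallyStable_of_exponential_decay (hp : p ≠ ∞)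
    (hcomp : IsCompositionSystem μ f) (hdiss : IsDissipativeSystemOfBoundedDistortion μ f W)
    (hinv : IsUnit (hcomp.compositionOperator p hp)) (S : Set ℤ) {r s : ℝ≥0} (hr : r < 1)
    (hs : s < 1)
    (hpast : ∀ᶠ n : ℕ in atTop, ∀ k ∈ S,
      μ (iterImage f (k - n) W) ≤ r ^ n * μ (iterImage f k W))
    (hfuture : ∀ᶠ n : ℕ in atTop, ∀ k ∉ S,
      μ (iterImage f (k + n) W) ≤ s ^ n * μ (iterImage f k W)) :
    StronglyStructurallyStable (hcomp.compositionOperator p hp) := by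
  obtain ⟨T, hT⟩ := hinv
  have hA (J : Set ℤ) : MeasurableSet (⋃ k ∈ J, iterImage f k W) :=
    .biUnion J.to_countable fun k _ => measurableSet_iterImage k hdiss.measurableSet
  have compl_eq : (⋃ k ∈ S, iterImage f k W)ᶜ = ⋃ k ∈ Sᶜ, iterImage f k W :=
    Set.biUnion_compl_eq_of_pairwise_disjoint_of_iUnion_eq_univ hdiss.iUnion_eq
      hdiss.pairwise_disjoint S
  have splitting : IsSummableSplitting T (lpIndicator (hA S)) := by
    constructor
    · exact summable_norm_zpow_mul_lpIndicator hp hcomp hdiss hT (hA S) hr (m := fun n => n) hpast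
    · simp only [one_sub_lpIndicator, compl_eq]
      have := summable_norm_zpow_mul_lpIndicator hp hcomp hdiss hT (hA Sᶜ) hs (m := fun n => -n)
        (by simpa using hfuture)
      simpa using this
  exact hT ▸ splitting.stronglyStructurallyStable

end ExponentialDecay

theorem exists_eventually_le_pow_mul_of_limsup_lt_one {ι : Type*} {a b : ℕ → ι → ℝ≥0∞}
    (hb : ∀ n i, b n i ≠ 0)
    (h : limsup (fun n : ℕ => ⨆ i, (a n i / b n i) ^ (1 / (n : ℝ))) atTop < 1) :
    ∃ r : ℝ≥0, r < 1 ∧ ∀ᶠ n in atTop, ∀ i, a n i ≤ r ^ n * b n i := by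
  obtain ⟨r, hr, hr_lt⟩ := ENNReal.lt_iff_exists_nnreal_btwn.1 (max_lt h zero_lt_one)
  refine ⟨r, mod_cast hr_lt, ?_⟩
  have hr_ne : (r : ℝ≥0∞) ≠ 0 := ((le_max_right _ _).trans_lt hr).ne'
  filter_upwards [eventually_lt_of_limsup_lt ((le_max_left _ _).trans_lt hr),
    eventually_gt_atTop 0] with n hn hn_pos i
  have root_le := (le_iSup (fun i => (a n i / b n i) ^ (1 / (n : ℝ))) i).trans hn.le
  rw [one_div, ENNReal.rpow_inv_le_iff (by exact_mod_cast hn_pos), ENNReal.rpow_natCast] at root_le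
  exact (ENNReal.div_le_iff_le_mul (.inl (hb n i)) (.inr (pow_ne_zero n hr_ne))).1 root_le

theorem exists_eventually_le_pow_mul_of_one_lt_liminf {ι : Type*} {a b : ℕ → ι → ℝ≥0∞}
    (h : 1 < liminf (fun n : ℕ => ⨅ i, (a n i / b n i) ^ (1 / (n : ℝ))) atTop) :
    ∃ r : ℝ≥0, r < 1 ∧ ∀ᶠ n in atTop, ∀ i, b n i ≤ r ^ n * a n i := by
  obtain ⟨s, one_lt_coe, hs⟩ := ENNReal.lt_iff_exists_nnreal_btwn.1 h
  have one_lt : 1 < s := mod_cast one_lt_coe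
  have s_ne : s ≠ 0 := (zero_lt_one.trans one_lt).ne'
  refine ⟨s⁻¹, inv_lt_one_of_one_lt₀ one_lt, ?_⟩
  filter_upwards [eventually_lt_of_lt_liminf hs, eventually_gt_atTop 0] with n hn hn_pos i
  have le_root := hn.le.trans (iInf_le (fun i => (a n i / b n i) ^ (1 / (n : ℝ))) i)
  rw [one_div, ENNReal.le_rpow_inv_iff (by exact_mod_cast hn_pos), ENNReal.rpow_natCast] at le_root
  rw [ENNReal.coe_inv s_ne, ← ENNReal.inv_pow, mul_comm, ← div_eq_mul_inv]
  exact (ENNReal.le_div_iff_mul_le (.inl (pow_ne_zero n (ENNReal.coe_ne_zero.2 s_ne)))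
    (.inl (ENNReal.pow_ne_top ENNReal.coe_ne_top))).2
    ((mul_comm _ _).trans_le (ENNReal.mul_le_of_le_div le_root))

theorem mainTheorem5 {X : Type*} [MeasurableSpace X] (μ : Measure X) (f : X ≃ᵐ X) (W : Set X)
    (p : ℝ≥0∞) [Fact (1 ≤ p)] (hp : p ≠ ∞)
    (hcomp : IsCompositionSystem μ f)
    (hdiss : IsDissipativeSystemOfBoundedDistortion μ f W)
    (hinv : IsUnit (hcomp.compositionOperator p hp))
    (hcond : ConditionHC μ f W ∨ ConditionHD μ f W ∨ ConditionGH μ f W) :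
    StronglyStructurallyStable (hcomp.compositionOperator p hp) := by
  have hW := hdiss.measure_iterImage_ne_zero
  rcases hcond with hHC | hHD | ⟨hpast, hfuture⟩
  · obtain ⟨r, hr, past⟩ := exists_eventually_le_pow_mul_of_limsup_lt_one (fun _ _ => hW _) hHC
    refine stronglyStructurallyStable_of_exponential_decay hp hcomp hdiss hinv Set.univ hr
      zero_lt_one (past.mono fun n hn k _ => ?_) (.of_forall fun _ _ hk => (hk trivial).elim)
    simpa using hn (k - n)
  · obtain ⟨s, hs, future⟩ := exists_eventually_le_pow_mul_of_one_lt_liminf hHD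
    exact stronglyStructurallyStable_of_exponential_decay hp hcomp hdiss hinv ∅ zero_lt_one hs
      (.of_forall fun _ _ hk => hk.elim) (future.mono fun n hn k _ => hn k)
  · obtain ⟨r, hr, past⟩ := exists_eventually_le_pow_mul_of_limsup_lt_one (fun _ _ => hW _) hpast
    obtain ⟨s, hs, future⟩ := exists_eventually_le_pow_mul_of_one_lt_liminf hfuture
    exact stronglyStructurallyStable_of_exponential_decay hp hcomp hdiss hinv {k | k ≤ 0} hr hs
      (past.mono fun n hn k hk => hn ⟨k, hk⟩)
      (future.mono fun n hn k hk => hn ⟨k, (not_le.1 hk).le⟩)
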